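/- Let $R$ and $S$ be commutative rings with unity, $f:R\to S$ a (unital) ring homomorphism and $J$ a proper ideal of $S$, and let $$R\bowtie^fJ=\{(r,f(r)+j)\mid r\in R,\ j\in J\}\subseteq R\times S$$ be the amalgamation of $R$ with $S$ along $J$ with respect to $f$. For a commutative ring $A$ let $\operatorname{Reg}(A)$ be the set of regular elements (non-zero-divisors) of $A$, let $\operatorname{Z}(A)=A\setminus\operatorname{Reg}(A)$ be the set of zero-divisors, and let $\operatorname{Jac}(A)$ be the Jacobson radical. The ring $A$ is called Prüfer if every nonzero finitely generated ideal of $A$ that contains a regular element is a projective $A$-module. For a maximal ideal $\mathfrak m$ of $R$ let $T_{\mathfrak m}=f(R\setminus\mathfrak m)+J$, a multiplicatively closed subset of $S$, and let $J_{T_{\mathfrak m}}=T_{\mathfrak m}^{-1}J$, an ideal of $T_{\mathfrak m}^{-1}S$. We say that $R\bowtie^fJ$ has condition $\star$ if $$\operatorname{Z}(R\bowtie^fJ)=\{(r,f(r)+j)\mid r\in\operatorname{Z}(R),\ j\in J\}\cup\{(r,f(r)+j)\mid r\in R,\ j\in J,\ j'(f(r)+j)=0\text{ for some }j'\in J\setminus\{0\}\}.$$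 Assume that $f(\operatorname{Reg}(R))\subseteq\operatorname{Reg}(S)$. (1) If $R\bowtie^fJ$ is a Prüfer ring, then $R$ is a Prüfer ring and $J_{T_{\mathfrak m}}=f(r)J_{T_{\mathfrak m}}$ for every maximal ideal $\mathfrak m$ of $R$ and every $r\in\operatorname{Reg}(R)$. (2) Assume that $R\bowtie^fJ$ has condition $\star$ and that $\operatorname{Z}(R\bowtie^fJ)\subseteq\operatorname{Jac}(R\bowtie^fJ)$. If $R$ is a Prüfer ring and $J_{T_{\mathfrak m}}=f(r)J_{T_{\mathfrak m}}$ for every maximal ideal $\mathfrak m$ of $R$ and every $r\in\operatorname{Reg}(R)$, then $R\bowtie^fJ$ is a Prüfer ring. -/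

import Mathlib

namespace Amalgam

universe u v

/-- The set `Z(A)` of zero-divisors of a commutative ring (so `0 ∈ Z(A)` when `A` is nontrivial). -/
def zeroDivisors (A : Type u) [CommRing A] : Set A :=
  {a | ∃ b : A, b ≠ 0 ∧ a * b = 0}

/-- Regular ideals: those containing a regular element. -/
def IsRegularIdeal {A : Type u} [CommRing A] (I : Ideal A) : Prop :=
  ∃ a ∈ I, a ∈ nonZeroDivisors A

/-- Prüfer rings (possibly with zero-divisors): every nonzero finitely generated regular ideal is
projective. -/
def IsPrufer (A : Type u) [CommRing A] : Prop :=
  ∀ I : Ideal A, I ≠ ⊥ → I.FG → IsRegularIdeal I → Module.Projective A I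

variable {R : Type u} {S : Type v} [CommRing R] [CommRing S]

/-- The amalgamation `R ⋈^f J = {(r, f r + j) | r ∈ R, j ∈ J}`, a subring of `R × S`. -/
def amalgamation (f : R →+* S) (J : Ideal S) : Subring (R × S) where
  carrier := {p | ∃ r : R, ∃ j ∈ J, p = (r, f r + j)}
  mul_mem' := by
    rintro _ _ ⟨r, j, hj, rfl⟩ ⟨r', j', hj', rfl⟩
    refine ⟨r * r', f r * j' + f r' * j + j * j',
      J.add_mem (J.add_mem (J.mul_mem_left _ hj') (J.mul_mem_left _ hj)) (J.mul_mem_left _ hj'), ?_⟩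
    simp only [Prod.mk_mul_mk, map_mul, Prod.mk.injEq, true_and]
    ring
  one_mem' := ⟨1, 0, J.zero_mem, by ext <;> simp⟩
  add_mem' := by
    rintro _ _ ⟨r, j, hj, rfl⟩ ⟨r', j', hj', rfl⟩
    refine ⟨r + r', j + j', J.add_mem hj hj', ?_⟩
    simp only [Prod.mk_add_mk, map_add, Prod.mk.injEq, true_and]
    ring
  zero_mem' := ⟨0, 0, J.zero_mem, by ext <;> simp⟩
  neg_mem' := by
    rintro _ ⟨r, j, hj, rfl⟩
    refine ⟨-r, -j, J.neg_mem hj, ?_⟩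
    simp only [Prod.neg_mk, map_neg, Prod.mk.injEq, true_and]
    ring

/-- Condition `⋆`: `Z(R ⋈^f J)` is the set of the `(r, f r + j)` with `r ∈ Z(R)`, together with the
`(r, f r + j)` with `j' (f r + j) = 0` for some nonzero `j' ∈ J`. -/
def ConditionStar (f : R →+* S) (J : Ideal S) : Prop :=
  zeroDivisors (amalgamation f J) =
    {x : amalgamation f J | ∃ r ∈ zeroDivisors R, ∃ j ∈ J, (x : R × S) = (r, f r + j)} ∪
    {x : amalgamation f J | ∃ r : R, ∃ j ∈ J, (x : R × S) = (r, f r + j) ∧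
      ∃ j' ∈ J, j' ≠ 0 ∧ j' * (f r + j) = 0}

/-- The multiplicative subset `T_p = f(R \ p) + J` of `S`. -/
def T (f : R →+* S) (J : Ideal S) (p : Ideal R) [p.IsPrime] : Submonoid S where
  carrier := {s | ∃ x : R, x ∉ p ∧ ∃ j ∈ J, s = f x + j}
  mul_mem' := by
    rintro _ _ ⟨x, hx, j, hj, rfl⟩ ⟨x', hx', j', hj', rfl⟩
    refine ⟨x * x', p.primeCompl.mul_mem hx hx', f x * j' + f x' * j + j * j',
      J.add_mem (J.add_mem (J.mul_mem_left _ hj') (J.mul_mem_left _ hj)) (J.mul_mem_left _ hj'), ?_⟩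
    rw [map_mul]
    ring
  one_mem' := ⟨1, p.primeCompl.one_mem, 0, J.zero_mem, by simp⟩

/-- The localization `J_{T_p} = T_p⁻¹ J`, as an ideal of `S_{T_p} = T_p⁻¹ S`. -/
def locJ (f : R →+* S) (J : Ideal S) (p : Ideal R) [p.IsPrime] : Ideal (Localization (T f J p)) :=
  J.map (algebraMap S (Localization (T f J p)))

/-- `J_{T_m} = f(r) J_{T_m}` for every maximal ideal `m` of `R` and every regular element `r`
of `R`. -/
def LocallyDivisible (f : R →+* S) (J : Ideal S) : Prop :=
  ∀ (m : Ideal R) [m.IsMaximal], ∀ r ∈ nonZeroDivisors R,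
    locJ f J m = Ideal.span {algebraMap S (Localization (T f J m)) (f r)} * locJ f J m

end Amalgam

/-! An ideal `I` containing a regular element `ρ` is projective iff `ρ ∈ I * ((ρ) : I)`, a
membership that survives any ring map keeping `ρ` regular. For (1), extending an ideal of `R` along
`r ↦ (r, f r)` and projecting back recovers it, so `R` is Prüfer; divisibility of `J` comes from
invertibility of the ideals generated by `(r, f r)` and `(0, j)`. For (2), `⋆` and the Jacobson
condition make `1 + J` consist of units, so `J = f(r) J` already holds in `S`. Every regular ideal
is then extended from its projection to `R`, where the Prüfer hypothesis applies. -/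

namespace Amalgam

open nonZeroDivisors

section Projective

variable {A : Type*} [CommRing A]

/-- Multiplication by `b ∈ (ρ : I)` on `I` can be divided by the regular element `ρ`. -/
theorem exists_linearMap_of_mem_colon {I : Ideal A} {ρ b : A} (hρ : ρ ∈ A⁰)
    (hb : b ∈ (Ideal.span {ρ}).colon (I : Set A)) :
    ∃ φ : I →ₗ[A] A, ∀ x : I, ρ * φ x = b * x := by
  have h : ∀ x : I, ∃ y, ρ * y = b * x := fun x ↦ by
    obtain ⟨y, hy⟩ := Ideal.mem_span_singleton.1 (Submodule.mem_colon.1 hb x x.2)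
    exact ⟨y, hy.symm⟩
  choose φ hφ using h
  refine ⟨{ toFun := φ, map_add' := fun x y ↦ ?_, map_smul' := fun a x ↦ ?_ }, hφ⟩
  · refine (mul_cancel_left_mem_nonZeroDivisors hρ).1 ?_
    rw [mul_add, hφ, hφ, hφ]
    simp [mul_add]
  · refine (mul_cancel_left_mem_nonZeroDivisors hρ).1 ?_
    rw [hφ, RingHom.id_apply, smul_eq_mul, mul_left_comm, hφ]
    simp [mul_left_comm]

/-- Dual basis: if `ρ = ∑ aᵢ bᵢ` with `aᵢ ∈ I` and `bᵢ ∈ (ρ) : I`, the maps `x ↦ bᵢ x / ρ` are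
coordinates for the generators `aᵢ`. -/
theorem projective_of_mem_mul_colon {I : Ideal A} {ρ : A} (hρ : ρ ∈ A⁰)
    (h : ρ ∈ I * (Ideal.span {ρ}).colon (I : Set A)) : Module.Projective A I := by
  -- Stated for every `x` in the product to allow induction; cancelling `ρ` in the case `x = ρ`
  -- gives the splitting.
  have key : ∀ x ∈ I * (Ideal.span {ρ}).colon (I : Set A), ∃ s : I →ₗ[A] I →₀ A,
      ∀ k : I, ρ • Finsupp.linearCombination A id (s k) = x • k := by
    intro x hx
    refine Submodule.mul_induction_on hx (fun a ha b hb ↦ ?_) fun x y hx hy ↦ ?_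
    · obtain ⟨φ, hφ⟩ := exists_linearMap_of_mem_colon hρ hb
      refine ⟨Finsupp.lsingle ⟨a, ha⟩ ∘ₗ φ, fun k ↦ Subtype.ext ?_⟩
      have := hφ k
      simp only [LinearMap.comp_apply, Finsupp.lsingle_apply, Finsupp.linearCombination_single,
        id_eq, Submodule.coe_smul, smul_eq_mul]
      linear_combination a * this
    · obtain ⟨s, hs⟩ := hx
      obtain ⟨t, ht⟩ := hy
      exact ⟨s + t, fun k ↦ by rw [LinearMap.add_apply, map_add, smul_add, hs, ht, add_smul]⟩
  obtain ⟨s, hs⟩ := key ρ h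
  refine ⟨s, fun k ↦ Subtype.ext ((mul_cancel_left_mem_nonZeroDivisors hρ).1 ?_)⟩
  simpa using congrArg Subtype.val (hs k)

/-- A section `s` writes `ρ = ∑ s(ρ)ₖ k`, and `x s(ρ) = ρ s(x)` puts each coefficient in `(ρ) : I`.
-/
theorem mem_mul_colon_of_projective {I : Ideal A} {ρ : A} (hρI : ρ ∈ I) [Module.Projective A I] :
    ρ ∈ I * (Ideal.span {ρ}).colon (I : Set A) := by
  obtain ⟨s, hs⟩ := Module.Projective.out (R := A) (P := I)
  have h := congrArg Subtype.val (hs ⟨ρ, hρI⟩)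
  rw [Finsupp.linearCombination_apply, Finsupp.sum, Submodule.coe_sum] at h
  refine (congrArg (· ∈ I * (Ideal.span {ρ}).colon (I : Set A)) h).mp ?_
  refine Ideal.sum_mem _ fun k _ ↦ ?_
  rw [Submodule.coe_smul, smul_eq_mul]
  refine Ideal.mul_mem_mul_rev k.2 (Submodule.mem_colon.2 fun x hx ↦ ?_)
  have hswap : x • s ⟨ρ, hρI⟩ = ρ • s ⟨x, hx⟩ := by
    rw [← map_smul, ← map_smul]
    congr 1
    exact Subtype.ext (mul_comm _ _)
  refine Ideal.mem_span_singleton.2 ⟨s ⟨x, hx⟩ k, ?_⟩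
  simpa [mul_comm] using DFunLike.congr_fun hswap k

theorem map_colon_le {B : Type*} [CommRing B] (φ : A →+* B) (I : Ideal A) (ρ : A) :
    ((Ideal.span {ρ}).colon (I : Set A)).map φ ≤
      (Ideal.span {φ ρ}).colon (I.map φ : Set B) := by
  refine Ideal.map_le_iff_le_comap.2 fun b hb ↦ Submodule.mem_colon.2 fun x hx ↦ ?_
  have hle : I.map φ ≤ (Ideal.span {φ ρ}).colon {φ b} := by
    refine Ideal.map_le_iff_le_comap.2 fun a ha ↦ ?_
    rw [Ideal.mem_comap, Submodule.mem_colon_singleton, smul_eq_mul, mul_comm, ← map_mul,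
      Ideal.mem_span_singleton]
    exact map_dvd φ (Ideal.mem_span_singleton.1 (Submodule.mem_colon.1 hb a ha))
  simpa [Submodule.mem_colon_singleton, mul_comm] using hle hx

/-- Projectivity of regular ideals is preserved by extension along a ring homomorphism that
preserves regularity of one of their elements. -/
theorem projective_map_of_projective {B : Type*} [CommRing B] (φ : A →+* B) {I : Ideal A} {ρ : A}
    (hρI : ρ ∈ I) (hρ : φ ρ ∈ B⁰) [Module.Projective A I] : Module.Projective B (I.map φ) := by
  refine projective_of_mem_mul_colon hρ ?_
  have h := Ideal.mem_map_of_mem φ (mem_mul_colon_of_projective hρI)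
  rw [Ideal.map_mul] at h
  exact Ideal.mul_mono_right (map_colon_le φ I ρ) h

theorem IsRegularIdeal.ne_bot [Nontrivial A] {I : Ideal A} (h : IsRegularIdeal I) : I ≠ ⊥ := by
  rintro rfl
  obtain ⟨a, ha, ha'⟩ := h
  exact nonZeroDivisors.ne_zero ha' ha

theorem mem_nonZeroDivisors_of_notMem_zeroDivisors {a : A} (h : a ∉ zeroDivisors A) : a ∈ A⁰ :=
  mem_nonZeroDivisors_iff_left.2 fun b hb ↦ by
    by_contra hb0
    exact h ⟨b, hb0, hb⟩

theorem notMem_zeroDivisors_of_mem_nonZeroDivisors {a : A} (h : a ∈ A⁰) : a ∉ zeroDivisors A :=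
  fun ⟨b, hb0, hb⟩ ↦ hb0 (mem_nonZeroDivisors_iff_left.1 h b hb)

end Projective

section Amalgamation

variable {R S : Type*} [CommRing R] [CommRing S] (f : R →+* S) (J : Ideal S)

/-- The diagonal embedding `r ↦ (r, f r)` of `R` into `R ⋈^f J`. -/
def diag : R →+* amalgamation f J :=
  ((RingHom.id R).prod f).codRestrict (amalgamation f J)
    fun r ↦ ⟨r, 0, J.zero_mem, by simp⟩

/-- The projection of `R ⋈^f J` onto `R`. -/
def proj : amalgamation f J →+* R :=
  (RingHom.fst R S).comp (amalgamation f J).subtype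

/-- The element `(0, j)` of `R ⋈^f J`. -/
def inr (j : J) : amalgamation f J :=
  ⟨(0, j), 0, j, j.2, by simp⟩

@[simp]
theorem coe_diag (r : R) : (diag f J r : R × S) = (r, f r) := rfl

@[simp]
theorem coe_inr (j : J) : (inr f J j : R × S) = (0, (j : S)) := rfl

theorem proj_apply (x : amalgamation f J) : proj f J x = (x : R × S).1 := rfl

@[simp]
theorem proj_diag (r : R) : proj f J (diag f J r) = r := rfl

@[simp]
theorem proj_inr (j : J) : proj f J (inr f J j) = 0 := rfl

theorem exists_eq_diag_add_inr (x : amalgamation f J) :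
    ∃ j : J, x = diag f J (proj f J x) + inr f J j := by
  obtain ⟨_, r, j, hj, rfl⟩ := x
  exact ⟨⟨j, hj⟩, Subtype.ext (by simp [proj_apply])⟩

variable {f J}

theorem diag_mem_nonZeroDivisors (hf : ∀ r ∈ R⁰, f r ∈ S⁰) {r : R} (hr : r ∈ R⁰) :
    diag f J r ∈ (amalgamation f J)⁰ := by
  refine mem_nonZeroDivisors_iff_left.2 fun x hx ↦ Subtype.ext ?_
  have h := congrArg Subtype.val hx
  exact Prod.ext (mem_nonZeroDivisors_iff_left.1 hr _ (congrArg Prod.fst h))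
    (mem_nonZeroDivisors_iff_left.1 (hf r hr) _ (congrArg Prod.snd h))

theorem isPrufer_of_isPrufer_amalgamation [Nontrivial R] (hf : ∀ r ∈ R⁰, f r ∈ S⁰)
    (h : IsPrufer (amalgamation f J)) : IsPrufer R := by
  rintro I - hI ⟨r, hrI, hr⟩
  have hmem := Ideal.mem_map_of_mem (diag f J) hrI
  have : Nontrivial (amalgamation f J) := (proj f J).domain_nontrivial
  have hreg : IsRegularIdeal (I.map (diag f J)) := ⟨_, hmem, diag_mem_nonZeroDivisors hf hr⟩
  have := h _ hreg.ne_bot (hI.map _) hreg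
  have hproj := projective_map_of_projective (proj f J) hmem (by simpa using hr)
  rwa [Ideal.map_map, show (proj f J).comp (diag f J) = RingHom.id R from rfl,
    Ideal.map_id] at hproj

/-- Invertibility gives `ρ = ρ b + (0, j) c` with `b` in the colon ideal. Projecting to `R` forces
`b = (1, 1 + u)`, and `b (0, j) ∈ (ρ)` is the claim. Since `1 + u` lies in every `T_m`, it becomes a
unit in each localization. -/
theorem exists_one_add_mul_eq [Nontrivial R] (hf : ∀ r ∈ R⁰, f r ∈ S⁰)
    (h : IsPrufer (amalgamation f J)) {r : R} (hr : r ∈ R⁰) (j : J) :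
    ∃ u ∈ J, ∃ z ∈ J, (1 + u) * (j : S) = f r * z := by
  have : Nontrivial (amalgamation f J) := (proj f J).domain_nontrivial
  set ρ := diag f J r with hρ
  have hρK : ρ ∈ Ideal.span {ρ, inr f J j} := Ideal.subset_span (by simp)
  have hreg : IsRegularIdeal (Ideal.span {ρ, inr f J j}) :=
    ⟨ρ, hρK, diag_mem_nonZeroDivisors hf hr⟩
  have := h _ hreg.ne_bot (Submodule.fg_span (Set.toFinite _)) hreg
  have hmem := mem_mul_colon_of_projective hρK
  generalize hC : (Ideal.span {ρ}).colon _ = C at hmem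
  rw [Ideal.span_insert, Ideal.sup_mul] at hmem
  obtain ⟨y, hy, z, hz, hyz⟩ := Submodule.mem_sup.1 hmem
  obtain ⟨b, hb, rfl⟩ := Ideal.mem_span_singleton_mul.1 hy
  obtain ⟨c, -, rfl⟩ := Ideal.mem_span_singleton_mul.1 hz
  have hb1 : proj f J b = 1 := by
    refine (mul_cancel_left_mem_nonZeroDivisors hr).1 ?_
    simpa [hρ] using congrArg (proj f J) hyz
  obtain ⟨u, hu⟩ := exists_eq_diag_add_inr f J b
  rw [← hC] at hb
  obtain ⟨w, hw⟩ := Ideal.mem_span_singleton.1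
    (Submodule.mem_colon.1 hb (inr f J j) (Ideal.subset_span (by simp)))
  have hw0 : proj f J w = 0 := by
    refine mem_nonZeroDivisors_iff_left.1 hr _ ?_
    simpa [hρ] using (congrArg (proj f J) hw).symm
  obtain ⟨v, hv⟩ := exists_eq_diag_add_inr f J w
  refine ⟨u, u.2, v, v.2, ?_⟩
  rw [hu, hv, hb1, hw0] at hw
  simpa [hρ] using congrArg (fun x : amalgamation f J ↦ (x : R × S).2) hw

theorem locallyDivisible_of_isPrufer [Nontrivial R] (hf : ∀ r ∈ R⁰, f r ∈ S⁰)
    (h : IsPrufer (amalgamation f J)) : LocallyDivisible f J := by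
  intro m hm r hr
  refine le_antisymm (Ideal.map_le_iff_le_comap.2 fun j hj ↦ ?_) Ideal.mul_le_right
  obtain ⟨u, hu, z, hz, huz⟩ := exists_one_add_mul_eq hf h hr ⟨j, hj⟩
  have hT : 1 + u ∈ T f J m :=
    ⟨1, m.primeCompl.one_mem, u, hu, by simp⟩
  rw [Ideal.mem_comap, ← Ideal.unit_mul_mem_iff_mem _
    (IsLocalization.map_units (Localization (T f J m)) ⟨1 + u, hT⟩), ← map_mul]
  simp only [huz, map_mul]
  exact Ideal.mul_mem_mul (Ideal.mem_span_singleton_self _) (Ideal.mem_map_of_mem _ hz)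

theorem mem_zeroDivisors_of_proj_mem (hstar : ConditionStar f J) {x : amalgamation f J}
    (hx : proj f J x ∈ zeroDivisors R) : x ∈ zeroDivisors (amalgamation f J) := by
  obtain ⟨_, r, j, hj, rfl⟩ := x
  rw [hstar]
  exact Or.inl ⟨r, hx, j, hj, rfl⟩

/-- By `⋆`, `(0, j)` is a zero-divisor because its first component is one, so it lies in the
Jacobson radical. -/
theorem isUnit_one_add_inr [Nontrivial R] (hstar : ConditionStar f J)
    (hjac : ∀ x ∈ zeroDivisors (amalgamation f J),
      x ∈ Ideal.jacobson (⊥ : Ideal (amalgamation f J))) (j : J) :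
    IsUnit (1 + inr f J j) := by
  have h := hjac (inr f J j) (mem_zeroDivisors_of_proj_mem hstar ⟨1, one_ne_zero, by simp⟩)
  simpa [add_comm] using Ideal.mem_jacobson_bot.1 h 1

/-- Local divisibility of `J` becomes global once `1 + J` consists of units. -/
theorem LocallyDivisible.exists_mul_eq (hJ : ∀ u ∈ J, IsUnit (1 + u)) (h : LocallyDivisible f J)
    {r : R} (hr : r ∈ R⁰) (j : J) : ∃ z : J, (j : S) = f r * z := by
  let N : Ideal S := Ideal.span {f r} * J
  -- If `f x + u ∈ T_m` multiplies `j` into `N`, then `x ∈ I` although `x ∉ m`; hence no maximal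
  -- ideal contains `I`.
  let I : Ideal R := (J ⊔ N.colon {(j : S)}).comap f
  have hI : I = ⊤ := by
    by_contra hne
    obtain ⟨m, hm, hIm⟩ := I.exists_le_maximal hne
    have hj : algebraMap S (Localization (T f J m)) j ∈ N.map (algebraMap S _) := by
      rw [Ideal.map_mul, Ideal.map_span, Set.image_singleton]
      exact h m r hr ▸ Ideal.mem_map_of_mem _ j.2
    rw [IsLocalization.algebraMap_mem_map_algebraMap_iff (T f J m)] at hj
    obtain ⟨_, ⟨x, hx, u, hu, rfl⟩, ht⟩ := hj
    refine hx (hIm ?_)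
    have := Ideal.add_mem _ (Ideal.mem_sup_left (J.neg_mem hu))
      (Ideal.mem_sup_right (S := J) (Submodule.mem_colon_singleton.2 ht))
    simpa [I] using this
  have h1 : (1 : S) ∈ J ⊔ N.colon {(j : S)} := by
    simpa [I] using (Ideal.eq_top_iff_one I).1 hI
  obtain ⟨u, hu, v, hv, huv⟩ := Submodule.mem_sup.1 h1
  have hv' : IsUnit v := by
    have := hJ _ (J.neg_mem hu)
    rwa [← huv, show u + v + -u = v by ring] at this
  rw [Submodule.mem_colon_singleton, smul_eq_mul, Ideal.unit_mul_mem_iff_mem _ hv',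
    Ideal.mem_span_singleton_mul] at hv
  obtain ⟨z, hz, hzj⟩ := hv
  exact ⟨⟨z, hz⟩, hzj.symm⟩

/-- If every element of `J` is divisible by `f r`, a regular ideal of `R ⋈^f J` is extended
from `R`. -/
theorem map_diag_map_proj_eq {K : Ideal (amalgamation f J)} {r : R}
    (hdiv : ∀ j : J, ∃ z : J, (j : S) = f r * z) (hr : diag f J r ∈ K) :
    (K.map (proj f J)).map (diag f J) = K := by
  -- Needed both for `K` and for the extended ideal: each contains `0 × J`, and modulo `0 × J` every
  -- element is diagonal.
  have hinr : ∀ j : J, ∀ L : Ideal (amalgamation f J), diag f J r ∈ L → inr f J j ∈ L := by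
    intro j L hL
    obtain ⟨z, hz⟩ := hdiv j
    have : inr f J j = diag f J r * inr f J z := Subtype.ext (by simp [hz])
    exact this ▸ L.mul_mem_right _ hL
  refine le_antisymm ?_ fun k hk ↦ ?_
  · rw [Ideal.map_map]
    refine Ideal.map_le_iff_le_comap.2 fun k hk ↦ ?_
    obtain ⟨j, hj⟩ := exists_eq_diag_add_inr f J k
    have := K.sub_mem hk (hinr j K hr)
    nth_rw 1 [hj] at this
    simpa using this
  · obtain ⟨j, hj⟩ := exists_eq_diag_add_inr f J k
    rw [hj]
    refine Ideal.add_mem _ (Ideal.mem_map_of_mem _ (Ideal.mem_map_of_mem _ hk)) (hinr j _ ?_)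
    simpa using Ideal.mem_map_of_mem (diag f J) (Ideal.mem_map_of_mem (proj f J) hr)

theorem isPrufer_amalgamation [Nontrivial R] (hf : ∀ r ∈ R⁰, f r ∈ S⁰)
    (hstar : ConditionStar f J)
    (hjac : ∀ x ∈ zeroDivisors (amalgamation f J),
      x ∈ Ideal.jacobson (⊥ : Ideal (amalgamation f J)))
    (hR : IsPrufer R) (h : LocallyDivisible f J) : IsPrufer (amalgamation f J) := by
  rintro K - hK ⟨ρ, hρK, hρ⟩
  have hunit := isUnit_one_add_inr hstar hjac
  have hunitS : ∀ u ∈ J, IsUnit (1 + u) := fun u hu ↦ by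
    simpa using (hunit ⟨u, hu⟩).map ((RingHom.snd R S).comp (amalgamation f J).subtype)
  set r := proj f J ρ with hr_def
  have hr : r ∈ R⁰ := mem_nonZeroDivisors_of_notMem_zeroDivisors fun hr ↦
    notMem_zeroDivisors_of_mem_nonZeroDivisors hρ (mem_zeroDivisors_of_proj_mem hstar hr)
  have hdiv := h.exists_mul_eq hunitS hr
  -- With `j = f r * z`, `ρ = (r, f r + j)` is the unit `1 + (0, z)` times `(r, f r)`.
  have hrK : diag f J r ∈ K := by
    obtain ⟨j, hj⟩ := exists_eq_diag_add_inr f J ρ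
    obtain ⟨z, hz⟩ := hdiv j
    have : ρ = (1 + inr f J z) * diag f J r := by
      refine hj.trans (Subtype.ext (Prod.ext ?_ ?_))
      · simp [← hr_def]
      · simp [hz, ← hr_def]
        ring
    rwa [this, Ideal.unit_mul_mem_iff_mem _ (hunit z)] at hρK
  have hrI : r ∈ K.map (proj f J) := Ideal.mem_map_of_mem _ hρK
  have hreg : IsRegularIdeal (K.map (proj f J)) := ⟨r, hrI, hr⟩
  have := hR _ hreg.ne_bot (hK.map _) hreg
  have := projective_map_of_projective (diag f J) hrI (diag_mem_nonZeroDivisors hf hr)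
  rwa [map_diag_map_proj_eq hdiv hrK] at this

end Amalgamation

end Amalgam

theorem mainTheorem1 {R : Type*} {S : Type*} [CommRing R] [CommRing S] (f : R →+* S)
    (J : Ideal S) (hJ : J ≠ ⊤)
    (hf : ∀ r ∈ nonZeroDivisors R, f r ∈ nonZeroDivisors S) :
    (Amalgam.IsPrufer (Amalgam.amalgamation f J) →
      Amalgam.IsPrufer R ∧ Amalgam.LocallyDivisible f J) ∧
    (Amalgam.ConditionStar f J →
      (∀ x ∈ Amalgam.zeroDivisors (Amalgam.amalgamation f J),
        x ∈ Ideal.jacobson (⊥ : Ideal (Amalgam.amalgamation f J))) →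
      Amalgam.IsPrufer R → Amalgam.LocallyDivisible f J →
      Amalgam.IsPrufer (Amalgam.amalgamation f J)) := by
  have : Nontrivial S := (Submodule.nontrivial_iff S).1 ⟨J, ⊤, hJ⟩
  have : Nontrivial R := f.domain_nontrivial
  exact ⟨fun h ↦ ⟨Amalgam.isPrufer_of_isPrufer_amalgamation hf h,
    Amalgam.locallyDivisible_of_isPrufer hf h⟩, Amalgam.isPrufer_amalgamation hf⟩
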